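/- For a function $f \in L^1(\mathbb{R})$, $x\in\mathbb{R}$ and $\varepsilon > 0$ put $$H_\varepsilon f(x) = \frac{1}{\pi}\int_{|t-x|>\varepsilon} \frac{f(t)}{x-t}\,dt, \qquad H^*f(x) = \sup_{\varepsilon>0} |H_\varepsilon f(x)| \in [0,\infty],$$ and let $\mathbb{1}_E$ denote the indicator function of a set $E$. For every set $e\subset\mathbb{R}$ of Lebesgue measure zero there exists a measurable set $E\subset\mathbb{R}$ of finite Lebesgue measure such that $$H^*\mathbb{1}_E(x) = \infty \quad\text{for every } x\in e.$$ -/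

import Mathlib

open MeasureTheory
open scoped ENNReal

/-- The truncated Hilbert transform
`H_ε f (x) = (1 / π) ∫_{|t - x| > ε} f(t) / (x - t) dt`. For `ε > 0` and `f` integrable the
integrand is integrable on the domain of integration. -/
noncomputable def truncHilbert (ε : ℝ) (f : ℝ → ℝ) (x : ℝ) : ℝ :=
  (1 / Real.pi) * ∫ t in {t : ℝ | ε < |t - x|}, f t / (x - t)

/-- The maximal Hilbert transform `H^* f (x) = sup_{ε > 0} |H_ε f (x)|`, with values
in `[0, ∞]`. -/
noncomputable def maximalHilbert (f : ℝ → ℝ) (x : ℝ) : ℝ≥0∞ :=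
  ⨆ (ε : ℝ) (_ : 0 < ε), ENNReal.ofReal |truncHilbert ε f x|

open Filter Topology

/-! Cover `e` at every level `k` by intervals of total length at most `4⁻ᵏ`, and place mass `m j =
2ᵏ r j` at the centre `c j` of each interval of radius `r j` (`exists_masses_of_null`). The total
mass is finite, yet `m j / r j` is unbounded over the intervals containing a given point of `e`. Let
`F z = s + ∑ m j / (c j - z)` with `s > 0`, and let `E` be the part of the real line where `F < 0`.
In the upper half-plane `Im F > 0`, and the boundary argument of `F` is `π` on `E` and `0`
elsewhere. Hence the conjugate Poisson integral of `E` is `log |F / s|`. At `x + i r j` it is at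
least `log (Im F / s)`, where `Im F ≥ m j / (2 r j)` if `|c j - x| ≤ r j`. It differs from the
truncated Hilbert integral at `ε = r j` by at most `π`, so `H^*` is infinite on `e`. For finitely
many poles, everything follows from the factorisation of `F` with interlacing zeros
(`exists_interlacing_zeros`), which also gives Boole's bound `|E| ≤ (∑ m j) / s`. That bound
controls the passage to infinitely many poles (`exists_set_log_le_integral_conjPoisson`). -/

/-! ### Poles, zeros and factorisation of `s + ∑ m d / (d - x)`. -/

lemma tendsto_sum_div_sub_nhdsGT {C : Finset ℝ} {m : ℝ → ℝ} {c : ℝ} (hc : c ∈ C)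
    (hm : 0 < m c) (s : ℝ) :
    Tendsto (fun x => s + ∑ d ∈ C, m d / (d - x)) (𝓝[>] c) atBot := by
  have h1 : Tendsto (fun x => s + ∑ d ∈ C.erase c, m d / (d - x)) (𝓝[>] c)
      (𝓝 (s + ∑ d ∈ C.erase c, m d / (d - c))) := by
    apply Tendsto.mono_left _ nhdsWithin_le_nhds
    refine tendsto_const_nhds.add (tendsto_finsetSum _ fun d hd => ?_)
    refine Tendsto.div tendsto_const_nhds (tendsto_const_nhds.sub tendsto_id) ?_
    exact sub_ne_zero.2 (Finset.ne_of_mem_erase hd)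
  have h2 : Tendsto (fun x => m c / (c - x)) (𝓝[>] c) atBot := by
    simp only [div_eq_mul_inv]
    refine Tendsto.const_mul_atBot hm (tendsto_inv_nhdsLT_zero.comp ?_)
    refine tendsto_nhdsWithin_of_tendsto_nhds_of_eventually_within _ ?_ ?_
    · apply Tendsto.mono_left _ nhdsWithin_le_nhds
      have : Tendsto (fun x : ℝ => c - x) (𝓝 c) (𝓝 (c - c)) := tendsto_const_nhds.sub tendsto_id
      simpa using this
    · filter_upwards [self_mem_nhdsWithin] with x hx
      simpa using hx
  refine (h1.add_atBot h2).congr fun x => ?_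
  rw [← Finset.add_sum_erase C _ hc]
  ring

lemma tendsto_sum_div_sub_nhdsLT {C : Finset ℝ} {m : ℝ → ℝ} {c : ℝ} (hc : c ∈ C)
    (hm : 0 < m c) (s : ℝ) :
    Tendsto (fun x => s + ∑ d ∈ C, m d / (d - x)) (𝓝[<] c) atTop := by
  have h1 : Tendsto (fun x => s + ∑ d ∈ C.erase c, m d / (d - x)) (𝓝[<] c)
      (𝓝 (s + ∑ d ∈ C.erase c, m d / (d - c))) := by
    apply Tendsto.mono_left _ nhdsWithin_le_nhds
    refine tendsto_const_nhds.add (tendsto_finsetSum _ fun d hd => ?_)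
    refine Tendsto.div tendsto_const_nhds (tendsto_const_nhds.sub tendsto_id) ?_
    exact sub_ne_zero.2 (Finset.ne_of_mem_erase hd)
  have h2 : Tendsto (fun x => m c / (c - x)) (𝓝[<] c) atTop := by
    simp only [div_eq_mul_inv]
    refine Tendsto.const_mul_atTop hm (tendsto_inv_nhdsGT_zero.comp ?_)
    refine tendsto_nhdsWithin_of_tendsto_nhds_of_eventually_within _ ?_ ?_
    · apply Tendsto.mono_left _ nhdsWithin_le_nhds
      have : Tendsto (fun x : ℝ => c - x) (𝓝 c) (𝓝 (c - c)) := tendsto_const_nhds.sub tendsto_id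
      simpa using this
    · filter_upwards [self_mem_nhdsWithin] with x hx
      simpa using hx
  refine (h1.add_atTop h2).congr fun x => ?_
  rw [← Finset.add_sum_erase C _ hc]
  ring

lemma tendsto_sum_div_sub_atTop (C : Finset ℝ) (m : ℝ → ℝ) (s : ℝ) :
    Tendsto (fun x => s + ∑ d ∈ C, m d / (d - x)) atTop (𝓝 s) := by
  have : Tendsto (fun x => s + ∑ d ∈ C, m d / (d - x)) atTop (𝓝 (s + ∑ d ∈ C, 0)) := by
    refine tendsto_const_nhds.add (tendsto_finsetSum _ fun d _ => ?_)
    refine Tendsto.const_div_atBot ?_ _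
    exact tendsto_atBot_add_const_left _ d tendsto_neg_atTop_atBot
  simpa using this

lemma continuousOn_sum_div_sub {C : Finset ℝ} (m : ℝ → ℝ) (s : ℝ) {A : Set ℝ}
    (hA : ∀ d ∈ C, d ∉ A) : ContinuousOn (fun x => s + ∑ d ∈ C, m d / (d - x)) A := by
  refine continuousOn_const.add (continuousOn_finsetSum _ fun d hd => ?_)
  refine continuousOn_const.div (continuousOn_const.sub continuousOn_id) fun x hx => ?_
  rintro h
  exact hA d hd (by rwa [sub_eq_zero.1 h])

/-- Between a pole of `s + ∑ m d / (d - x)` and the next one there is a zero. -/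
lemma exists_zero_right_of_pole {C : Finset ℝ} {m : ℝ → ℝ} (hm : ∀ c ∈ C, 0 < m c) {s : ℝ}
    (hs : 0 < s) {c : ℝ} (hc : c ∈ C) :
    ∃ a, c < a ∧ (∀ d ∈ C, c < d → a < d) ∧ s + ∑ d ∈ C, m d / (d - a) = 0 := by
  by_cases hne : (C.filter (c < ·)).Nonempty
  · obtain ⟨b, hb, hmin⟩ : ∃ b ∈ C.filter (c < ·), ∀ d ∈ C.filter (c < ·), b ≤ d :=
      ⟨_, Finset.min'_mem _ hne, fun d hd => Finset.min'_le _ d hd⟩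
    simp only [Finset.mem_filter, and_imp] at hb hmin
    have hcont : ContinuousOn (fun x => s + ∑ d ∈ C, m d / (d - x)) (Set.Ioo c b) :=
      continuousOn_sum_div_sub m s fun d hd h => absurd (hmin d hd h.1) (not_le.2 h.2)
    have := isPreconnected_Ioo.intermediate_value_Iii
      (le_principal_iff.2 (Ioo_mem_nhdsGT hb.2)) (le_principal_iff.2 (Ioo_mem_nhdsLT hb.2)) hcont
      (tendsto_sum_div_sub_nhdsGT hc (hm c hc) s) (tendsto_sum_div_sub_nhdsLT hb.1 (hm b hb.1) s)
    obtain ⟨a, ha, ha0⟩ := this (Set.mem_univ (0 : ℝ))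
    exact ⟨a, ha.1, fun d hd h => ha.2.trans_le (hmin d hd h), ha0⟩
  -- To the right of the last pole the function runs from `-∞` to its limit `s > 0`.
  · have hmax : ∀ d ∈ C, ¬ c < d := fun d hd h => hne ⟨d, Finset.mem_filter.2 ⟨hd, h⟩⟩
    have hcont : ContinuousOn (fun x => s + ∑ d ∈ C, m d / (d - x)) (Set.Ioi c) :=
      continuousOn_sum_div_sub m s hmax
    have := isPreconnected_Ioi.intermediate_value_Iio
      (le_principal_iff.2 self_mem_nhdsWithin) (le_principal_iff.2 (Ioi_mem_atTop c)) hcont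
      (tendsto_sum_div_sub_nhdsGT hc (hm c hc) s) (tendsto_sum_div_sub_atTop C m s)
    obtain ⟨a, ha, ha0⟩ := this (Set.mem_Iio.2 hs)
    exact ⟨a, ha, fun d hd h => absurd h (hmax d hd), ha0⟩

/-- The numerator of `s + ∑ m d / (d - X)`. -/
noncomputable def poleNumerator (C : Finset ℝ) (m : ℝ → ℝ) (s : ℝ) : Polynomial ℝ :=
  Polynomial.C s * Lagrange.nodal C id
    - ∑ c ∈ C, Polynomial.C (m c) * Lagrange.nodal (C.erase c) id

/-- A general ring hom serves both the real line and the upper half-plane. -/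
lemma eval₂_poleNumerator {K : Type*} [Field K] (f : ℝ →+* K) (C : Finset ℝ) (m : ℝ → ℝ) (s : ℝ)
    {z : K} (hz : ∀ c ∈ C, z ≠ f c) :
    (poleNumerator C m s).eval₂ f z
      = (f s + ∑ c ∈ C, f (m c) / (f c - z)) * ∏ c ∈ C, (z - f c) := by
  simp only [poleNumerator, Lagrange.nodal, Polynomial.eval₂_sub, Polynomial.eval₂_mul,
    Polynomial.eval₂_C, Polynomial.eval₂_finsetSum, Polynomial.eval₂_finsetProd,
    Polynomial.eval₂_X, id, add_mul, Finset.sum_mul]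
  rw [sub_eq_add_neg, ← Finset.sum_neg_distrib]
  congr 1
  refine Finset.sum_congr rfl fun c hc => ?_
  rw [← Finset.mul_prod_erase C _ hc]
  have : f c - z ≠ 0 := sub_ne_zero.2 (hz c hc).symm
  field_simp
  ring

/-- Both sides have leading term `s X ^ #C`, so their difference has degree below `#C`, and it
vanishes at the `#C` distinct points `a c`. -/
lemma poleNumerator_eq_of_zeros {C : Finset ℝ} {m : ℝ → ℝ} {s : ℝ} {a : ℝ → ℝ}
    (ha : Set.InjOn a C) (hne : ∀ c ∈ C, a c ∉ C)
    (h0 : ∀ c ∈ C, s + ∑ d ∈ C, m d / (d - a c) = 0) :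
    poleNumerator C m s = Polynomial.C s * Lagrange.nodal C a := by
  rcases C.eq_empty_or_nonempty with rfl | hC
  · simp [poleNumerator]
  refine Polynomial.eq_of_degree_sub_lt_of_eval_index_eq (v := a) C ha ?_ fun c hc => ?_
  · have : poleNumerator C m s - Polynomial.C s * Lagrange.nodal C a
        = Polynomial.C s * (Lagrange.nodal C id - Lagrange.nodal C a)
          - ∑ c ∈ C, Polynomial.C (m c) * Lagrange.nodal (C.erase c) id := by
      rw [poleNumerator]; ring
    rw [this]
    refine (Polynomial.degree_sub_le _ _).trans_lt (max_lt ?_ ?_)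
    · rw [Polynomial.C_mul']
      refine (Polynomial.degree_smul_le _ _).trans_lt ?_
      refine (Polynomial.degree_sub_lt_left (by simp) (Lagrange.nodal_ne_zero) ?_).trans_le
        Lagrange.degree_nodal.le
      rw [Lagrange.nodal_monic.leadingCoeff, Lagrange.nodal_monic.leadingCoeff]
    · refine (Polynomial.degree_sum_le _ _).trans_lt ?_
      refine (Finset.sup_lt_iff (WithBot.bot_lt_coe _)).2 fun c hc => ?_
      rw [Polynomial.C_mul']
      refine (Polynomial.degree_smul_le _ _).trans_lt ?_
      rw [Lagrange.degree_nodal]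
      exact_mod_cast Finset.card_erase_lt_of_mem hc
  · have := eval₂_poleNumerator (RingHom.id ℝ) C m s (z := a c)
      (fun d hd h => hne c hc (h ▸ hd))
    simp only [Polynomial.eval₂_id, RingHom.id_apply] at this
    rw [this, h0 c hc, zero_mul, Polynomial.eval_mul, Lagrange.eval_nodal_at_node hc, mul_zero]

/-- Vieta: compare the coefficients of `X ^ (#C - 1)`. -/
lemma sum_zeros_sub_poles {C : Finset ℝ} {m : ℝ → ℝ} {s : ℝ} (hs : s ≠ 0) {a : ℝ → ℝ}
    (h : poleNumerator C m s = Polynomial.C s * Lagrange.nodal C a) :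
    ∑ c ∈ C, (a c - c) = (∑ c ∈ C, m c) / s := by
  rcases C.eq_empty_or_nonempty with rfl | hC
  · simp
  have hcard := hC.card_pos
  have h1 := congrArg (fun p => p.coeff (C.card - 1)) h
  simp only [poleNumerator, Polynomial.coeff_sub, Polynomial.coeff_C_mul,
    Polynomial.finsetSum_coeff] at h1
  have h2 : ∀ c ∈ C, m c * (Lagrange.nodal (C.erase c) id).coeff (C.card - 1) = m c := by
    intro c hc
    have : (Lagrange.nodal (C.erase c) (id : ℝ → ℝ)).natDegree = C.card - 1 := by
      rw [Lagrange.natDegree_nodal, Finset.card_erase_of_mem hc]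
    rw [← this, Polynomial.coeff_natDegree, Lagrange.nodal_monic.leadingCoeff, mul_one]
  rw [Finset.sum_congr rfl h2, Lagrange.nodal, Lagrange.nodal,
    Polynomial.prod_X_sub_C_coeff_card_pred _ _ hcard,
    Polynomial.prod_X_sub_C_coeff_card_pred _ _ hcard] at h1
  rw [Finset.sum_sub_distrib, eq_div_iff hs]
  simp only [id] at h1
  linarith

/-- Product form of `s + ∑ m c / (c - z)`, with zeros interlacing the poles. -/
lemma exists_interlacing_zeros {C : Finset ℝ} {m : ℝ → ℝ} (hm : ∀ c ∈ C, 0 < m c) {s : ℝ}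
    (hs : 0 < s) :
    ∃ a : ℝ → ℝ, (∀ c ∈ C, c < a c) ∧ (∀ c ∈ C, ∀ d ∈ C, c < d → a c < d) ∧
      (∑ c ∈ C, (a c - c) = (∑ c ∈ C, m c) / s) ∧
      (∀ x : ℝ, x ∉ C →
        s + ∑ c ∈ C, m c / (c - x) = s * ∏ c ∈ C, ((x - a c) / (x - c))) ∧
      (∀ z : ℂ, (∀ c ∈ C, z ≠ c) →
        s + ∑ c ∈ C, (m c : ℂ) / (c - z) = s * ∏ c ∈ C, ((z - a c) / (z - c))) := by
  choose! a ha1 ha2 ha3 using fun c (hc : c ∈ C) => exists_zero_right_of_pole hm hs hc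
  have hlt : ∀ c ∈ C, ∀ d ∈ C, c < d → a c < a d := fun c hc d hd h =>
    (ha2 c hc d hd h).trans (ha1 d hd)
  have hinj : Set.InjOn a C := by
    intro c hc d hd h
    rcases lt_trichotomy c d with h' | h' | h'
    · exact absurd h (hlt c hc d hd h').ne
    · exact h'
    · exact absurd h (hlt d hd c hc h').ne'
  have hne : ∀ c ∈ C, a c ∉ C := by
    intro c hc h
    exact lt_irrefl _ (ha2 c hc _ h (ha1 c hc))
  have hP := poleNumerator_eq_of_zeros hinj hne ha3
  have key : ∀ {K : Type} [Field K] (f : ℝ →+* K) (z : K), (∀ c ∈ C, z ≠ f c) →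
      f s + ∑ c ∈ C, f (m c) / (f c - z) = f s * ∏ c ∈ C, ((z - f (a c)) / (z - f c)) := by
    intro K _ f z hz
    have h0 : ∏ c ∈ C, (z - f c) ≠ 0 :=
      Finset.prod_ne_zero_iff.2 fun c hc => sub_ne_zero.2 (hz c hc)
    rw [Finset.prod_div_distrib, ← mul_div_assoc, eq_div_iff h0, ← eval₂_poleNumerator f C m s hz,
      hP]
    simp [Lagrange.nodal, Polynomial.eval₂_mul, Polynomial.eval₂_finsetProd]
  refine ⟨a, ha1, ha2, sum_zeros_sub_poles hs.ne' hP, fun x hx => ?_, fun z hz => ?_⟩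
  · exact key (RingHom.id ℝ) x fun c hc h => hx (by simpa [h] using hc)
  · exact key Complex.ofRealHom z hz

/-! ### Boole's bound and the conjugate Poisson integral for finitely many poles. -/

/-- The conjugate Poisson kernel `(t - x) / ((t - x) ^ 2 + y ^ 2)`. -/
noncomputable def conjPoisson (x y t : ℝ) : ℝ := (t - x) / ((t - x) ^ 2 + y ^ 2)

lemma continuous_conjPoisson (x : ℝ) {y : ℝ} (hy : 0 < y) : Continuous (conjPoisson x y) := by
  unfold conjPoisson
  refine Continuous.div (by fun_prop) (by fun_prop) fun t => ?_
  positivity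

lemma setIntegral_Ioo_conjPoisson (x : ℝ) {y : ℝ} (hy : 0 < y) {a b : ℝ} (hab : a ≤ b) :
    ∫ t in Set.Ioo a b, conjPoisson x y t
      = Real.log ‖(⟨x, y⟩ : ℂ) - b‖ - Real.log ‖(⟨x, y⟩ : ℂ) - a‖ := by
  have hlog : ∀ t : ℝ, Real.log ‖(⟨x, y⟩ : ℂ) - t‖ = 1 / 2 * Real.log ((t - x) ^ 2 + y ^ 2) := by
    intro t
    have h : ‖(⟨x, y⟩ : ℂ) - t‖ = √((t - x) ^ 2 + y ^ 2) := by
      rw [Complex.norm_def, Complex.normSq_apply]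
      congr 1
      simp
      ring
    rw [h, Real.log_sqrt (by positivity)]
    ring
  have hderiv : ∀ t ∈ Set.uIcc a b,
      HasDerivAt (fun t => 1 / 2 * Real.log ((t - x) ^ 2 + y ^ 2)) (conjPoisson x y t) t := by
    intro t _
    have h1 : HasDerivAt (fun t : ℝ => (t - x) ^ 2 + y ^ 2) (2 * (t - x)) t := by
      simpa using (((hasDerivAt_id t).sub_const x).pow 2).add_const (y ^ 2)
    have h0 : (t - x) ^ 2 + y ^ 2 ≠ 0 := by positivity
    refine ((h1.log h0).const_mul (1 / 2)).congr_deriv ?_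
    unfold conjPoisson
    field_simp
  rw [← integral_Ioc_eq_integral_Ioo, ← intervalIntegral.integral_of_le hab,
    intervalIntegral.integral_eq_sub_of_hasDerivAt hderiv
      ((continuous_conjPoisson x hy).intervalIntegrable a b), hlog, hlog]

/-- Each factor `(x - a c) / (x - c)` is negative exactly on `(c, a c)`; these intervals are
disjoint, so at most one factor is negative at a time. The poles are excluded because division by
zero gives a meaningless value there. -/
lemma sum_div_sub_lt_zero_ae_eq {C : Finset ℝ} {m a : ℝ → ℝ} {s : ℝ} (hs : 0 < s)
    (ha1 : ∀ c ∈ C, c < a c) (ha2 : ∀ c ∈ C, ∀ d ∈ C, c < d → a c < d)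
    (hprod : ∀ x : ℝ, x ∉ C →
        s + ∑ c ∈ C, m c / (c - x) = s * ∏ c ∈ C, ((x - a c) / (x - c))) :
    {x | s + ∑ c ∈ C, m c / (c - x) < 0} =ᵐ[volume] ⋃ c ∈ C, Set.Ioo c (a c) := by
  have hC : ∀ᵐ x : ℝ, x ∉ C := by
    have : volume (C : Set ℝ) = 0 := C.finite_toSet.measure_zero _
    simpa using measure_eq_zero_iff_ae_notMem.1 this
  have hfac : ∀ c ∈ C, ∀ x, x ∉ C → x ∉ Set.Ioo c (a c) → 0 ≤ (x - a c) / (x - c) := by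
    intro c hc x hx h
    rcases lt_or_gt_of_ne (show x ≠ c from fun h => hx (h ▸ hc)) with h' | h'
    · exact div_nonneg_of_nonpos (by linarith [ha1 c hc]) (by linarith)
    · have : a c ≤ x := not_lt.1 fun h2 => h ⟨h', h2⟩
      exact div_nonneg (by linarith) (by linarith)
  filter_upwards [hC] with x hx
  refine propext (show s + ∑ c ∈ C, m c / (c - x) < 0 ↔ x ∈ ⋃ c ∈ C, Set.Ioo c (a c) from ?_)
  rw [hprod x hx]
  simp only [Set.mem_iUnion, exists_prop]
  constructor
  · intro h
    by_contra! h'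
    exact absurd h (not_lt.2 (mul_nonneg hs.le (Finset.prod_nonneg fun c hc =>
      hfac c hc x hx (h' c hc))))
  · rintro ⟨c, hc, hxc⟩
    refine mul_neg_of_pos_of_neg hs ?_
    rw [← Finset.mul_prod_erase C _ hc]
    refine mul_neg_of_neg_of_pos
      (div_neg_of_neg_of_pos (sub_neg.2 hxc.2) (sub_pos.2 hxc.1)) (Finset.prod_pos fun d hd => ?_)
    obtain ⟨hdc, hd⟩ := Finset.mem_erase.1 hd
    rcases lt_or_gt_of_ne hdc with h | h
    · have h1 := ha2 d hd c hc h
      exact div_pos (by linarith [hxc.1]) (by linarith [hxc.1])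
    · have h1 := ha2 c hc d hd h
      have h2 := ha1 d hd
      exact div_pos_of_neg_of_neg (by linarith [hxc.2]) (by linarith [hxc.2])

/-- Boole's identity (as an inequality) and the conjugate Poisson integral of the set where
`s + ∑ m c / (c - x)` is negative. -/
lemma measure_le_and_integral_conjPoisson_of_finset {C : Finset ℝ} {m : ℝ → ℝ}
    (hm : ∀ c ∈ C, 0 < m c) {s : ℝ} (hs : 0 < s) :
    volume {x | s + ∑ c ∈ C, m c / (c - x) < 0} ≤ ENNReal.ofReal ((∑ c ∈ C, m c) / s) ∧
    ∀ x y : ℝ, 0 < y → ∫ t in {x | s + ∑ c ∈ C, m c / (c - x) < 0}, conjPoisson x y t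
      = Real.log (‖(s : ℂ) + ∑ c ∈ C, (m c : ℂ) / (c - ⟨x, y⟩)‖ / s) := by
  obtain ⟨a, ha1, ha2, hsum, hreal, hcomplex⟩ := exists_interlacing_zeros hm hs
  have hae := sum_div_sub_lt_zero_ae_eq hs ha1 ha2 hreal
  refine ⟨?_, fun x y hy => ?_⟩
  · rw [measure_congr hae, ← hsum,
      ENNReal.ofReal_sum_of_nonneg fun c hc => sub_nonneg.2 (ha1 c hc).le]
    refine (measure_biUnion_finset_le _ _).trans (Finset.sum_le_sum fun c _ => ?_)
    rw [Real.volume_Ioo]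
  · have hdisj : (C : Set ℝ).Pairwise (Function.onFun Disjoint fun c => Set.Ioo c (a c)) := by
      intro c hc d hd hcd
      refine Set.disjoint_left.2 fun x hxc hxd => ?_
      rcases lt_or_gt_of_ne hcd with h | h
      · exact absurd (ha2 c hc d hd h) (not_lt.2 (hxd.1.trans hxc.2).le)
      · exact absurd (ha2 d hd c hc h) (not_lt.2 (hxc.1.trans hxd.2).le)
    have hz : ∀ r : ℝ, (⟨x, y⟩ : ℂ) - r ≠ 0 := fun r h => by
      have := congrArg Complex.im h
      simp at this
      exact hy.ne' this
    rw [setIntegral_congr_set hae, integral_biUnion_finset C (fun _ _ => measurableSet_Ioo) hdisj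
      fun c _ => ((continuous_conjPoisson x hy).integrableOn_Icc).mono_set Set.Ioo_subset_Icc_self,
      hcomplex _ fun c _ => sub_ne_zero.1 (hz c), norm_mul, norm_prod, Complex.norm_real,
      Real.norm_of_nonneg hs.le, mul_div_cancel_left₀ _ hs.ne', Real.log_prod
        fun c _ => norm_ne_zero_iff.2 (div_ne_zero (hz _) (hz _))]
    refine Finset.sum_congr rfl fun c hc => ?_
    rw [setIntegral_Ioo_conjPoisson x hy (ha1 c hc).le, norm_div,
      Real.log_div (norm_ne_zero_iff.2 (hz _)) (norm_ne_zero_iff.2 (hz _))]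

/-- The version of `measure_le_and_integral_conjPoisson_of_finset` for families of poles that need
not be distinct. -/
lemma measure_le_and_integral_conjPoisson {ι : Type*} (F : Finset ι) (c m : ι → ℝ)
    (hm : ∀ i, 0 < m i) {s : ℝ} (hs : 0 < s) :
    volume {x | s + ∑ i ∈ F, m i / (c i - x) < 0} ≤ ENNReal.ofReal ((∑ i ∈ F, m i) / s) ∧
    ∀ x y : ℝ, 0 < y → ∫ t in {x | s + ∑ i ∈ F, m i / (c i - x) < 0}, conjPoisson x y t
      = Real.log (‖(s : ℂ) + ∑ i ∈ F, (m i : ℂ) / (c i - ⟨x, y⟩)‖ / s) := by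
  classical
  -- Coinciding poles are merged and their masses added.
  have h := measure_le_and_integral_conjPoisson_of_finset (C := F.image c)
    (m := fun r => ∑ i ∈ F with c i = r, m i) (fun r hr => by
      obtain ⟨i, hi, rfl⟩ := Finset.mem_image.1 hr
      exact Finset.sum_pos (fun j _ => hm j) ⟨i, by simp [hi]⟩) hs
  have h1 : ∑ r ∈ F.image c, ∑ i ∈ F with c i = r, m i = ∑ i ∈ F, m i :=
    Finset.sum_image' m fun i _ => rfl
  have h2 : ∀ x : ℝ, ∑ r ∈ F.image c, (∑ i ∈ F with c i = r, m i) / (r - x)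
      = ∑ i ∈ F, m i / (c i - x) := fun x => by
    refine Finset.sum_image' (fun i => m i / (c i - x)) fun i _ => ?_
    rw [Finset.sum_div]
    exact Finset.sum_congr rfl fun j hj => by rw [(Finset.mem_filter.1 hj).2]
  have h3 : ∀ z : ℂ, ∑ r ∈ F.image c, ((∑ i ∈ F with c i = r, m i : ℝ) : ℂ) / (r - z)
      = ∑ i ∈ F, (m i : ℂ) / (c i - z) := fun z => by
    refine Finset.sum_image' (fun i => (m i : ℂ) / (c i - z)) fun i _ => ?_
    rw [Complex.ofReal_sum, Finset.sum_div]
    exact Finset.sum_congr rfl fun j hj => by rw [(Finset.mem_filter.1 hj).2]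
  simpa only [h1, h2, h3] using h

/-- All terms of the sum have positive imaginary part at `x + iy`, so the modulus dominates the
imaginary part of any single term. -/
lemma log_le_integral_conjPoisson {ι : Type*} (F : Finset ι) (c m : ι → ℝ)
    (hm : ∀ i, 0 < m i) {s : ℝ} (hs : 0 < s) (x : ℝ) {y : ℝ} (hy : 0 < y) {j : ι} (hj : j ∈ F) :
    Real.log (m j * y / ((c j - x) ^ 2 + y ^ 2) / s)
      ≤ ∫ t in {x | s + ∑ i ∈ F, m i / (c i - x) < 0}, conjPoisson x y t := by
  rw [(measure_le_and_integral_conjPoisson F c m hm hs).2 x y hy]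
  have hmj := hm j
  have him : ∀ i, ((m i : ℂ) / (c i - ⟨x, y⟩)).im = m i * y / ((c i - x) ^ 2 + y ^ 2) := by
    intro i
    simp [Complex.div_im, Complex.normSq_apply]
    ring
  refine Real.log_le_log (by positivity) (div_le_div_of_nonneg_right ?_ hs.le)
  refine le_trans ?_ (Complex.abs_im_le_norm _)
  refine le_trans ?_ (le_abs_self _)
  simp only [Complex.add_im, Complex.ofReal_im, Complex.im_sum, him, zero_add]
  exact Finset.single_le_sum (f := fun i => m i * y / ((c i - x) ^ 2 + y ^ 2))
    (fun i _ => by have := hm i; positivity) hj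

/-! ### Passage to infinitely many poles. -/

/-- Boole's bound handles one sign; the reflection `x ↦ -x` handles the other. -/
lemma volume_abs_sum_div_sub_gt_le {ι : Type*} (F : Finset ι) (c m : ι → ℝ)
    (hm : ∀ i, 0 < m i) {s : ℝ} (hs : 0 < s) :
    volume {x | s < |∑ i ∈ F, m i / (c i - x)|} ≤ 2 * ENNReal.ofReal ((∑ i ∈ F, m i) / s) := by
  have h1 := (measure_le_and_integral_conjPoisson F c m hm hs).1
  have h2 := (measure_le_and_integral_conjPoisson F (fun i => - c i) m hm hs).1
  rw [← Measure.measure_neg (volume : Measure ℝ)] at h2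
  rw [two_mul]
  refine (measure_mono fun x hx => ?_).trans ((measure_union_le _ _).trans (add_le_add h1 h2))
  rcases lt_abs.1 (Set.mem_ofPred_eq ▸ hx : s < |_|) with h | h
  · right
    have : ∑ i ∈ F, m i / (-c i - -x) = - ∑ i ∈ F, m i / (c i - x) := by
      rw [← Finset.sum_neg_distrib]
      exact Finset.sum_congr rfl fun i _ => by rw [← neg_sub', div_neg]
    simp only [Set.mem_neg, Set.mem_ofPred_eq, this]
    linarith
  · left
    simp only [Set.mem_ofPred_eq]
    linarith

/-- Choose blocks of mass at most `4⁻ⁿ`. The weak-type bound at height `2⁻ⁿ` leaves exceptional sets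
of measure at most `2 · 2⁻ⁿ`, and Borel–Cantelli makes the partial sums Cauchy almost everywhere. -/
lemma exists_subseq_ae_tendsto_sum_div_sub {c m : ℕ → ℝ} (hm : ∀ i, 0 < m i) (hsum : Summable m) :
    ∃ φ : ℕ → ℕ, StrictMono φ ∧ ∃ S : ℝ → ℝ, Measurable S ∧
      ∀ᵐ x, Tendsto (fun n => ∑ i ∈ Finset.range (φ n), m i / (c i - x)) atTop (𝓝 (S x)) := by
  have htail : ∀ n : ℕ, ∀ᶠ k in atTop, ∑' i, m (i + k) < (1 / 4 : ℝ) ^ n := fun n =>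
    (tendsto_sum_nat_add m).eventually_lt_const (by positivity)
  obtain ⟨φ, hφ, hφt⟩ := extraction_forall_of_eventually htail
  refine ⟨φ, hφ, ?_⟩
  set f : ℕ → ℝ → ℝ := fun n x => ∑ i ∈ Finset.range (φ n), m i / (c i - x) with hf
  have hblock : ∀ n, ∑ i ∈ Finset.Ico (φ n) (φ (n + 1)), m i ≤ (1 / 4 : ℝ) ^ n := by
    intro n
    refine le_trans ?_ (hφt n).le
    rw [Finset.sum_Ico_eq_sum_range]
    simp only [add_comm (φ n)]
    exact ((summable_nat_add_iff _).2 hsum).sum_le_tsum _ fun i _ => (hm _).le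
  have hdiff : ∀ n x, f (n + 1) x - f n x
      = ∑ i ∈ Finset.Ico (φ n) (φ (n + 1)), m i / (c i - x) := fun n x =>
    (Finset.sum_Ico_eq_sub _ (hφ n.lt_succ_self).le).symm
  have hbad : ∀ n, volume {x | (1 / 2 : ℝ) ^ n < |f (n + 1) x - f n x|}
      ≤ 2 * ENNReal.ofReal ((1 / 2 : ℝ) ^ n) := by
    intro n
    simp only [hdiff]
    refine (volume_abs_sum_div_sub_gt_le _ c m hm (by positivity)).trans ?_
    gcongr
    rw [div_le_iff₀ (by positivity), ← mul_pow]
    norm_num only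
    exact (hblock n).trans_eq (by norm_num)
  have hsum_bad : ∑' n, volume {x | (1 / 2 : ℝ) ^ n < |f (n + 1) x - f n x|} ≠ ∞ := by
    refine ne_top_of_le_ne_top ?_ (ENNReal.tsum_le_tsum hbad)
    rw [ENNReal.tsum_mul_left, ← ENNReal.ofReal_tsum_of_nonneg (fun n => by positivity)
      summable_geometric_two]
    exact ENNReal.mul_ne_top (by simp) ENNReal.ofReal_ne_top
  refine measurable_limit_of_tendsto_metrizable_ae (f := f) (fun n => ?_) ?_
  · refine Measurable.aemeasurable ?_
    simp only [hf]
    fun_prop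
  · filter_upwards [ae_eventually_notMem hsum_bad] with x hx
    obtain ⟨N, hN⟩ := eventually_atTop.1 hx
    have : CauchySeq fun n => f (n + N) x := by
      refine cauchySeq_of_le_geometric (1 / 2) ((1 / 2) ^ N) (by norm_num) fun n => ?_
      have h := hN (n + N) (by omega)
      replace h := not_lt.1 h
      rw [dist_comm, Real.dist_eq, add_right_comm, ← pow_add, add_comm N]
      exact h
    obtain ⟨l, hl⟩ := cauchySeq_tendsto_of_complete this
    exact ⟨l, (tendsto_add_atTop_iff_nat N).1 hl⟩

/-- Dominated convergence applies on a bounded interval. Outside it, smallness of the kernel and the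
common volume bound `V` control the integrals uniformly in `n`. -/
lemma tendsto_setIntegral_of_eventually_mem_iff {K : ℝ → ℝ} {B V : ℝ} (hK : Measurable K)
    (hB : ∀ t, |K t| ≤ B) (hK0 : ∀ δ > 0, ∃ R, ∀ t, R < |t| → |K t| ≤ δ) (hV : 0 ≤ V)
    {A : ℕ → Set ℝ} {E : Set ℝ} (hAm : ∀ n, MeasurableSet (A n)) (hEm : MeasurableSet E)
    (hA : ∀ n, volume (A n) ≤ ENNReal.ofReal V) (hE : volume E ≤ ENNReal.ofReal V)
    (hAE : ∀ᵐ t, ∀ᶠ n in atTop, t ∈ A n ↔ t ∈ E) :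
    Tendsto (fun n => ∫ t in A n, K t) atTop (𝓝 (∫ t in E, K t)) := by
  have hint : ∀ {A : Set ℝ}, volume A ≤ ENNReal.ofReal V → IntegrableOn K A := fun {A} h =>
    Measure.integrableOn_of_bounded (h.trans_lt ENNReal.ofReal_lt_top).ne
      hK.aestronglyMeasurable (Eventually.of_forall hB)
  rw [Metric.tendsto_atTop']
  intro ε hε
  obtain ⟨R, hR⟩ := hK0 (ε / (4 * (V + 1))) (by positivity)
  set I := Set.Icc (-R) R with hI
  have hsplit : ∀ {A : Set ℝ}, volume A ≤ ENNReal.ofReal V →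
      |(∫ t in A, K t) - ∫ t in A ∩ I, K t| ≤ ε / 4 := by
    intro A h
    have h1 := integral_inter_add_sdiff (s := A) (t := I) (f := K) measurableSet_Icc (hint h)
    have h2 : ‖∫ t in A \ I, K t‖ ≤ ε / (4 * (V + 1)) * volume.real (A \ I) := by
      refine norm_setIntegral_le_of_norm_le_const
        ((measure_mono Set.sdiff_subset).trans_lt (h.trans_lt ENNReal.ofReal_lt_top)) fun t ht => ?_
      refine hR t (not_le.1 fun h' => ht.2 (abs_le.1 h'))
    have h3 : volume.real (A \ I) ≤ V :=
      ENNReal.toReal_le_of_le_ofReal hV ((measure_mono Set.sdiff_subset).trans h)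
    rw [← h1, add_sub_cancel_left]
    refine h2.trans ((mul_le_mul_of_nonneg_left h3 (by positivity)).trans ?_)
    rw [div_mul_eq_mul_div, div_le_div_iff₀ (by positivity) (by norm_num)]
    nlinarith
  have hlim : Tendsto (fun n => ∫ t in A n ∩ I, K t) atTop (𝓝 (∫ t in E ∩ I, K t)) := by
    simp only [Set.inter_comm _ I]
    simp only [← setIntegral_indicator (hAm _), ← setIntegral_indicator hEm]
    refine tendsto_integral_of_dominated_convergence (fun _ => B)
      (fun n => (hK.indicator (hAm n)).aestronglyMeasurable) (integrable_const B)
      (fun n => Eventually.of_forall fun t => ?_) ?_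
    · exact (norm_indicator_le_norm_self K t).trans (hB t)
    · filter_upwards [ae_restrict_of_ae hAE] with t ht
      refine tendsto_const_nhds.congr' ?_
      filter_upwards [ht] with n hn
      by_cases h : t ∈ E <;> simp [h, hn]
  obtain ⟨N, hN⟩ := (Metric.tendsto_atTop'.1 hlim) (ε / 2) (by positivity)
  refine ⟨N, fun n hn => ?_⟩
  have h1 := abs_le.1 (hsplit (hA n))
  have h2 := abs_le.1 (hsplit hE)
  have h3 := abs_lt.1 (hN n hn)
  rw [Real.dist_eq, abs_lt]
  constructor <;> linarith [h1.1, h1.2, h2.1, h2.2, h3.1, h3.2]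

lemma abs_conjPoisson_le (x : ℝ) {y : ℝ} (hy : 0 < y) (t : ℝ) : |conjPoisson x y t| ≤ y⁻¹ := by
  have h0 : 0 < (t - x) ^ 2 + y ^ 2 := by positivity
  rw [conjPoisson, abs_div, abs_of_pos h0, inv_eq_one_div, div_le_div_iff₀ h0 hy]
  nlinarith [sq_nonneg (|t - x| - y), sq_abs (t - x), sq_nonneg (t - x), sq_nonneg y]

lemma abs_conjPoisson_le_of_lt (x : ℝ) {y : ℝ} (hy : 0 < y) {δ : ℝ} (hδ : 0 < δ) :
    ∃ R, ∀ t, R < |t| → |conjPoisson x y t| ≤ δ := by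
  refine ⟨|x| + δ⁻¹, fun t ht => ?_⟩
  have h0 : 0 < (t - x) ^ 2 + y ^ 2 := by positivity
  have h1 : δ⁻¹ < |t - x| := by linarith [abs_sub_abs_le_abs_sub t x]
  have h2 : 0 < |t - x| := (inv_pos.2 hδ).trans h1
  have h3 : 1 ≤ δ * |t - x| := by
    rw [inv_eq_one_div, div_lt_iff₀ hδ] at h1
    linarith
  rw [conjPoisson, abs_div, abs_of_pos h0, div_le_iff₀ h0, ← sq_abs (t - x)]
  nlinarith [mul_le_mul_of_nonneg_right h3 h2.le, mul_pos hδ (pow_pos hy 2)]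

/-- A set of finite measure whose conjugate Poisson integral is large near the poles `c j`, on the
scale on which the mass `m j` is large. -/
lemma exists_set_log_le_integral_conjPoisson {c m : ℕ → ℝ} (hm : ∀ i, 0 < m i)
    (hsum : Summable m) :
    ∃ (s : ℝ) (E : Set ℝ), 0 < s ∧ MeasurableSet E ∧ volume E < ∞ ∧ ∀ (x y : ℝ) (j : ℕ), 0 < y →
      Real.log (m j * y / ((c j - x) ^ 2 + y ^ 2) / s) ≤ ∫ t in E, conjPoisson x y t := by
  obtain ⟨φ, hφ, S, hS, hlim⟩ := exists_subseq_ae_tendsto_sum_div_sub (c := c) hm hsum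
  -- Only countably many level sets of `S` have positive measure. Choosing `s` so that `{S = -s}` is
  -- null forces membership in the approximating sets to stabilise almost everywhere.
  obtain ⟨u, hu0, hu⟩ : ∃ u ∈ Set.Iio (0 : ℝ), u ∈ {t | 0 < volume {a | S a = t}}ᶜ :=
    ((Measure.countable_meas_level_set_pos hS).dense_compl ℝ).exists_mem_open isOpen_Iio
      ⟨-1, by norm_num⟩ |>.imp fun _ h => ⟨h.2, h.1⟩
  obtain ⟨s, rfl⟩ : ∃ s, u = -s := ⟨-u, by simp⟩
  have hs : 0 < s := by simpa using hu0
  have hnull : ∀ᵐ x, S x ≠ -s := by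
    have : volume {a | S a = -s} = 0 := by simpa using hu
    exact measure_eq_zero_iff_ae_notMem.1 this
  set A : ℕ → Set ℝ := fun n => {x | s + ∑ i ∈ Finset.range (φ n), m i / (c i - x) < 0} with hA
  set E : Set ℝ := {x | s + S x < 0} with hE
  have hAm : ∀ n, MeasurableSet (A n) := fun n =>
    measurableSet_lt (by fun_prop) measurable_const
  have hEm : MeasurableSet E := measurableSet_lt (by fun_prop) measurable_const
  have hAE : ∀ᵐ t, ∀ᶠ n in atTop, t ∈ A n ↔ t ∈ E := by
    filter_upwards [hlim, hnull] with t ht ht0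
    have h := ht.const_add s
    rcases lt_or_gt_of_ne (show s + S t ≠ 0 from fun h => ht0 (by linarith)) with h' | h'
    · filter_upwards [h.eventually_lt_const h'] with n hn
      exact ⟨fun _ => h', fun _ => hn⟩
    · filter_upwards [h.eventually_const_lt h'] with n hn
      exact ⟨fun h2 => absurd h2 (not_lt.2 hn.le), fun h2 => absurd h2 (not_lt.2 h'.le)⟩
  set V := (∑' i, m i) / s with hV
  have hV0 : 0 ≤ V := div_nonneg (tsum_nonneg fun i => (hm i).le) hs.le
  have hAV : ∀ n, volume (A n) ≤ ENNReal.ofReal V := fun n =>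
    (measure_le_and_integral_conjPoisson (Finset.range (φ n)) c m hm hs).1.trans
      (ENNReal.ofReal_le_ofReal (div_le_div_of_nonneg_right
        (hsum.sum_le_tsum _ fun i _ => (hm i).le) hs.le))
  have hEV : volume E ≤ ENNReal.ofReal V := by
    -- Fatou for sets: almost all of `E` lies in the lower limit of the `A n`.
    have hmono : Monotone fun n => ⋂ k, A (n + k) := by
      refine monotone_nat_of_le_succ fun n => Set.subset_iInter fun k => ?_
      rw [add_right_comm, add_assoc]
      exact Set.iInter_subset _ (k + 1)
    calc volume E ≤ volume (⋃ n, ⋂ k, A (n + k)) := by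
          refine measure_mono_ae ?_
          filter_upwards [hAE] with t ht htE
          obtain ⟨N, hN⟩ := eventually_atTop.1 ht
          exact Set.mem_iUnion.2 ⟨N, Set.mem_iInter.2 fun k => (hN _ (by omega)).2 htE⟩
      _ ≤ ENNReal.ofReal V := by
          rw [hmono.measure_iUnion]
          exact iSup_le fun n => (measure_mono (Set.iInter_subset _ 0)).trans (hAV _)
  refine ⟨s, E, hs, hEm, hEV.trans_lt ENNReal.ofReal_lt_top, fun x y j hy => ?_⟩
  refine ge_of_tendsto (tendsto_setIntegral_of_eventually_mem_iff
    (continuous_conjPoisson x hy).measurable (abs_conjPoisson_le x hy)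
    (fun δ hδ => abs_conjPoisson_le_of_lt x hy hδ) hV0 hAm hEm hAV hEV hAE) ?_
  filter_upwards [eventually_gt_atTop j] with n hn
  exact log_le_integral_conjPoisson _ c m hm hs x hy (Finset.mem_range.2 (hn.trans_le (hφ.id_le n)))

/-! ### Comparison with the truncated Hilbert transform. -/

lemma integrable_poisson (x : ℝ) {y : ℝ} (hy : 0 < y) :
    Integrable fun t : ℝ => y⁻¹ * (1 + ((t - x) / y) ^ 2)⁻¹ :=
  ((integrable_inv_one_add_sq.comp_div hy.ne').comp_sub_right x).const_mul _

lemma integral_poisson (x : ℝ) {y : ℝ} (hy : 0 < y) :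
    ∫ t : ℝ, y⁻¹ * (1 + ((t - x) / y) ^ 2)⁻¹ = Real.pi := by
  rw [integral_const_mul, integral_sub_right_eq_self (fun t : ℝ => (1 + (t / y) ^ 2)⁻¹) x,
    Measure.integral_comp_div (fun t : ℝ => (1 + t ^ 2)⁻¹) y, integral_univ_inv_one_add_sq,
    abs_of_pos hy, smul_eq_mul, inv_mul_cancel_left₀ hy.ne']

/-- The truncated kernel `1 / (x - t)` has the opposite sign to `conjPoisson`, so the two are added.
Their sum is dominated pointwise by the Poisson kernel, whose integral is `π`. -/
lemma abs_integral_conjPoisson_sub_pi_le {E : Set ℝ} (hE : MeasurableSet E) (hfin : volume E < ∞)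
    (x : ℝ) {y : ℝ} (hy : 0 < y) :
    |∫ t in E, conjPoisson x y t| - Real.pi
      ≤ |∫ t in {t : ℝ | y < |t - x|}, E.indicator (fun _ => (1 : ℝ)) t / (x - t)| := by
  set U : Set ℝ := {t : ℝ | y < |t - x|} with hU
  have hUm : MeasurableSet U := measurableSet_lt measurable_const (by fun_prop)
  have h1 : Integrable (E.indicator (conjPoisson x y)) := by
    refine (integrable_indicator_iff hE).2 (Measure.integrableOn_of_bounded hfin.ne
      (continuous_conjPoisson x hy).aestronglyMeasurable
      (Eventually.of_forall (abs_conjPoisson_le x hy)))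
  have hgeq : ∀ t, U.indicator (fun t => E.indicator (fun _ => (1 : ℝ)) t / (x - t)) t
      = E.indicator (U.indicator fun t => 1 / (x - t)) t := by
    intro t
    by_cases h : t ∈ U <;> by_cases h' : t ∈ E <;> simp [h, h']
  have h2 : Integrable (E.indicator (U.indicator fun t => 1 / (x - t))) := by
    refine (integrable_indicator_iff hE).2 (Measure.integrableOn_of_bounded (M := y⁻¹) hfin.ne
      (Measurable.aestronglyMeasurable (Measurable.indicator (by fun_prop) hUm))
      (Eventually.of_forall fun t => ?_))
    by_cases h : t ∈ U
    · rw [Set.indicator_of_mem h, one_div, norm_inv, Real.norm_eq_abs, abs_sub_comm]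
      exact inv_anti₀ hy (le_of_lt h)
    · rw [Set.indicator_of_notMem h, norm_zero]
      positivity
  have hsum : |(∫ t in E, conjPoisson x y t)
      + ∫ t in U, E.indicator (fun _ => (1 : ℝ)) t / (x - t)| ≤ Real.pi := by
    rw [← integral_indicator (f := conjPoisson x y) hE, ← integral_indicator hUm]
    simp only [hgeq]
    rw [← integral_add h1 h2, ← integral_poisson x hy, ← Real.norm_eq_abs]
    refine norm_integral_le_of_norm_le (integrable_poisson x hy) (Eventually.of_forall fun t => ?_)
    have hP : y⁻¹ * (1 + ((t - x) / y) ^ 2)⁻¹ = y / ((t - x) ^ 2 + y ^ 2) := by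
      field_simp
      ring
    have h0 : 0 < (t - x) ^ 2 + y ^ 2 := by positivity
    rw [hP]
    by_cases hE' : t ∈ E
    swap
    · simp only [Set.indicator_of_notMem hE', add_zero, norm_zero]
      positivity
    rw [Set.indicator_of_mem hE', Set.indicator_of_mem hE', Real.norm_eq_abs]
    by_cases h : t ∈ U
    · have hlt : y < |t - x| := h
      have hne : t - x ≠ 0 := fun h' => by
        rw [h', abs_zero] at hlt
        exact hlt.not_gt hy
      -- Since `|t - x| > y` here, one factor `y` cancels against `|t - x|`, leaving the Poisson
      -- kernel as a bound.
      have : conjPoisson x y t + 1 / (x - t) = -(y ^ 2 / ((t - x) * ((t - x) ^ 2 + y ^ 2))) := by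
        rw [conjPoisson, ← neg_sub t x]
        field_simp
        ring
      rw [Set.indicator_of_mem h, this, abs_neg, abs_div, abs_mul, abs_of_pos h0,
        abs_of_pos (pow_pos hy 2), div_le_div_iff₀ (mul_pos (hy.trans hlt) h0) h0]
      nlinarith [mul_pos hy h0]
    · have hle : |t - x| ≤ y := not_lt.1 h
      rw [Set.indicator_of_notMem h, add_zero, conjPoisson, abs_div, abs_of_pos h0]
      gcongr
  have := abs_sub_abs_le_abs_sub (∫ t in E, conjPoisson x y t)
    (-∫ t in U, E.indicator (fun _ => (1 : ℝ)) t / (x - t))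
  rw [sub_neg_eq_add, abs_neg] at this
  linarith

/-! ### Covering the null set and conclusion. -/

/-- A null set is covered, for every `N`, by intervals `[c j - r j, c j + r j]` carrying mass
`m j ≥ N * r j`, with finite total mass. -/
lemma exists_masses_of_null {e : Set ℝ} (he : volume e = 0) (hne : e.Nonempty) :
    ∃ c r m : ℕ → ℝ, (∀ i, 0 < r i) ∧ (∀ i, 0 < m i) ∧ Summable m ∧
      ∀ x ∈ e, ∀ N : ℝ, ∃ j, |c j - x| ≤ r j ∧ N * r j ≤ m j := by
  have hcov : ∀ k : ℕ, ∃ (t : Set ℝ) (r : ℝ → ℝ), t.Countable ∧ (∀ x ∈ t, 0 < r x) ∧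
      e ⊆ ⋃ x ∈ t, Metric.closedBall x (r x) ∧
      ∑' x : t, volume (Metric.closedBall (x : ℝ) (r x)) ≤ ENNReal.ofReal ((1 / 4) ^ k) := by
    intro k
    obtain ⟨t, r, ht, -, hr, hcover, hsum⟩ :=
      Besicovitch.exists_closedBall_covering_tsum_measure_le (volume : Measure ℝ)
        (ε := ENNReal.ofReal ((1 / 4) ^ k)) (by simp) (fun _ => Set.Ioi 0) e
        fun x _ δ hδ => ⟨δ / 2, by simpa using hδ, by simpa using hδ, by linarith⟩
    exact ⟨t, r, ht, hr, hcover, by simpa only [he, zero_add] using hsum⟩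
  choose t r ht hr hcover hsum using hcov
  obtain ⟨x₀, hx₀⟩ := hne
  have hpt : ∀ k, Nonempty (t k) := fun k => by
    obtain ⟨c, hc, -⟩ := Set.mem_iUnion₂.1 (hcover k hx₀)
    exact ⟨c, hc⟩
  have : ∀ k, Countable (t k) := fun k => (ht k).to_subtype
  -- Every level is nonempty because `e` is, so the intervals of all levels together can be
  -- enumerated by `ℕ`.
  have : Infinite (Σ k, t k) :=
    Infinite.of_surjective (Sigma.fst : (Σ k, t k) → ℕ) fun k => ⟨⟨k, (hpt k).some⟩, rfl⟩
  obtain ⟨hden⟩ := nonempty_denumerable (Σ k, t k)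
  let f : ℕ ≃ Σ k, t k := (Denumerable.eqv _).symm
  -- The weight `2 ^ k` tends to infinity, while level `k` has total mass at most `2 ^ k · 4⁻ᵏ =
  -- 2⁻ᵏ`.
  set m : (Σ k, t k) → ℝ := fun i => 2 ^ i.1 * r i.1 i.2 with hm
  have hrpos : ∀ i : Σ k, t k, 0 < r i.1 i.2 := fun i => hr i.1 i.2 i.2.2
  have hmpos : ∀ i, 0 < m i := fun i => mul_pos (by positivity) (hrpos i)
  have hlevel : ∀ k, ∑' i : t k, ENNReal.ofReal (m ⟨k, i⟩) ≤ ENNReal.ofReal ((1 / 2) ^ k) := by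
    intro k
    calc ∑' i : t k, ENNReal.ofReal (m ⟨k, i⟩)
        ≤ ∑' i : t k, ENNReal.ofReal (2 ^ k) * volume (Metric.closedBall (i : ℝ) (r k i)) := by
          refine ENNReal.tsum_le_tsum fun i => ?_
          rw [Real.volume_closedBall, ← ENNReal.ofReal_mul (by positivity)]
          refine ENNReal.ofReal_le_ofReal (mul_le_mul_of_nonneg_left ?_ (by positivity))
          linarith [hrpos ⟨k, i⟩]
      _ ≤ ENNReal.ofReal (2 ^ k) * ENNReal.ofReal ((1 / 4) ^ k) := by
          rw [ENNReal.tsum_mul_left]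
          exact mul_le_mul_right (hsum k) _
      _ = ENNReal.ofReal ((1 / 2) ^ k) := by
          rw [← ENNReal.ofReal_mul (by positivity), ← mul_pow]
          norm_num
  have hmsum : Summable m := by
    have : ∑' i, ENNReal.ofReal (m i) ≠ ∞ := by
      rw [ENNReal.tsum_sigma']
      refine ne_top_of_le_ne_top ?_ (ENNReal.tsum_le_tsum hlevel)
      rw [← ENNReal.ofReal_tsum_of_nonneg (fun n => by positivity) summable_geometric_two]
      exact ENNReal.ofReal_ne_top
    exact (ENNReal.summable_toReal this).congr fun i => ENNReal.toReal_ofReal (hmpos i).le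
  refine ⟨fun n => (f n).2, fun n => r (f n).1 (f n).2, fun n => m (f n), fun n => hrpos _,
    fun n => hmpos _, hmsum.comp_injective f.injective, fun x hx N => ?_⟩
  obtain ⟨k, hk⟩ := pow_unbounded_of_one_lt N (one_lt_two : (1 : ℝ) < 2)
  obtain ⟨c, hc, hxc⟩ := Set.mem_iUnion₂.1 (hcover k hx)
  obtain ⟨j, hj⟩ := f.surjective ⟨k, c, hc⟩
  refine ⟨j, ?_⟩
  beta_reduce
  rw [hj]
  refine ⟨?_, mul_le_mul_of_nonneg_right hk.le (hrpos ⟨k, c, hc⟩).le⟩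
  rw [abs_sub_comm]
  exact hxc

theorem theorem1 (e : Set ℝ) (he : volume e = 0) :
    ∃ E : Set ℝ, MeasurableSet E ∧ volume E < ∞ ∧
      ∀ x ∈ e, maximalHilbert (E.indicator (fun _ => (1 : ℝ))) x = ∞ := by
  rcases e.eq_empty_or_nonempty with rfl | hne
  · exact ⟨∅, MeasurableSet.empty, by simp, by simp⟩
  obtain ⟨c, r, m, hr, hm, hsum, hcov⟩ := exists_masses_of_null he hne
  obtain ⟨s, E, hs, hE, hfin, hlog⟩ := exists_set_log_le_integral_conjPoisson (c := c) hm hsum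
  refine ⟨E, hE, hfin, fun x hx => ENNReal.eq_top_of_forall_nnreal_le fun b => ?_⟩
  -- The factor `2` absorbs `(c j - x) ^ 2 + r j ^ 2 ≤ 2 * r j ^ 2`, and `s` the normalisation in
  -- the logarithm. In the exponent, `π b` offsets the prefactor `1 / π` and the extra `π` the
  -- Poisson error.
  obtain ⟨j, hj, hmj⟩ := hcov x hx (2 * s * Real.exp (Real.pi * b + Real.pi))
  have hrj := hr j
  have hsq : (c j - x) ^ 2 ≤ r j ^ 2 := sq_le_sq.2 (hj.trans (le_abs_self _))
  have h1 : Real.pi * b + Real.pi ≤ ∫ t in E, conjPoisson x (r j) t := by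
    refine le_trans ?_ (hlog x (r j) j hrj)
    rw [← Real.log_exp (Real.pi * b + Real.pi)]
    refine Real.log_le_log (Real.exp_pos _) ?_
    rw [le_div_iff₀ hs, le_div_iff₀ (by positivity)]
    calc Real.exp (Real.pi * b + Real.pi) * s * ((c j - x) ^ 2 + r j ^ 2)
        ≤ Real.exp (Real.pi * b + Real.pi) * s * (r j ^ 2 + r j ^ 2) := by gcongr
      _ = 2 * s * Real.exp (Real.pi * b + Real.pi) * r j * r j := by ring
      _ ≤ m j * r j := by gcongr
  have h2 := abs_integral_conjPoisson_sub_pi_le hE hfin x hrj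
  have h3 : (b : ℝ) ≤ |truncHilbert (r j) (E.indicator fun _ => (1 : ℝ)) x| := by
    rw [truncHilbert, abs_mul, abs_of_pos (by positivity), one_div, inv_mul_eq_div,
      le_div_iff₀ Real.pi_pos]
    linarith [le_abs_self (∫ t in E, conjPoisson x (r j) t)]
  calc (b : ℝ≥0∞) = ENNReal.ofReal b := (ENNReal.ofReal_coe_nnreal).symm
    _ ≤ ENNReal.ofReal |truncHilbert (r j) (E.indicator fun _ => (1 : ℝ)) x| :=
        ENNReal.ofReal_le_ofReal h3
    _ ≤ maximalHilbert (E.indicator fun _ => (1 : ℝ)) x := by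
        unfold maximalHilbert
        exact le_iSup₂ (f := fun (ε : ℝ) (_ : 0 < ε) =>
          ENNReal.ofReal |truncHilbert ε (E.indicator fun _ => (1 : ℝ)) x|) (r j) hrj
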